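/- **Setting.** Let $\sigma>0$, $\mathcal H=\{2^{-k}:k=1,2,\dots\}$ and, for $h\in\mathcal H$, $\mathcal G_h=\{h,3h,\dots,1-h\}$, $n_h=1/(2h)=|\mathcal G_h|$, $\sigma_h=\sigma\sqrt{2/h}$. One observes $\hat\theta_{h,t}=\theta_{h,t}+\sigma_h\xi_{h,t}$, $h\in\mathcal H$, $t\in\mathcal G_h$, with independent standard Gaussian $\xi_{h,t}$; $\mathbf P_\Theta$ is the law of the observations for $\Theta=(\theta_{h,t})$. Let $\Phi$ be the standard Gaussian distribution function, $S(x)=1/\Phi(x)-1$, and $$Z^M_h=\max_{t\in\mathcal G_h}\log\Bigl[\frac1{n_h}S\Bigl(\frac{\hat\theta_{h,t}}{\sigma_h}\Bigr)\Bigr].$$ **Test.** Let $\alpha\in(0,1)$, $q_\alpha^\varkappa=-\log\log\frac1{1-\alpha}$, $\varepsilon\in(0,1)$ and $m\in\{0,1,2,\dots\}$. Put $\psi_0(x)=1+\log x$, $\psi_l(x)=\psi_0(\psi_{l-1}(x))$ for $l\ge 1$, and $$\Pi_h=\frac1{\{\psi_m[\log_2(1/h)]\}^{\varepsilon}}-\frac1{\{\psi_m[\log_2(1/h)+1]\}^{\varepsilon}},\qquad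 h\in\mathcal H .$$ The adaptive MAP test rejects the null hypothesis when $\sup_{h}\{Z_h^M+\log\Pi_h\}\ge q_\alpha^\varkappa$. For $A\ge0$ let $\Theta_{\rho,\tau}(A)$ be the set of all $\Theta$ with $\theta_{\rho,\tau}=-A$ and $\theta_{h,t}\ge0$ for $(h,t)\ne(\rho,\tau)$, and let $$\beta^\Pi_{\rho,\tau}(A)=\sup_{\Theta\in\Theta_{\rho,\tau}(A)}\mathbf P_\Theta\Bigl\{\sup_{h\in\mathcal H}\,[Z_h^M+\log\Pi_h]\le q_\alpha^\varkappa\Bigr\}.$$ **Priors.** Let $\nu$ be a probability density on $(0,\infty)$ that is bounded, continuous at almost every point, and satisfies $\int_0^\infty \nu(x)\,|\log\nu(x)|\,dx<\infty$, $\int_0^\infty\nu(x)\log(x+1)\,dx<\infty$ and $\frac1\omega\sum_{k\ge1}\nu(k/\omega)\to1$ as $\omega\to\infty$. For $\omega$ large let $$\bar\pi_h^{\omega,\nu}=\nu\Bigl(\frac{\log_2(1/h)}{\omega}\Bigr)\Big/\sum_{k=1}^\infty\nu\Bigl(\frac k\omega\Bigr),\qquad h\in\mathcal H,$$ let $\mathbf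 E_{\bar\pi^{\omega,\nu}}$ be the expectation over $h$ drawn from $\bar\pi^{\omega,\nu}$, and for $\mathbf A=(A_h)_{h\in\mathcal H}$ let $$\bar\beta^{\Pi}_{\bar\pi^{\omega,\nu}}(\mathbf A)=\sum_{h\in\mathcal H}\frac{\bar\pi_h^{\omega,\nu}}{n_h}\sum_{t\in\mathcal G_h}\beta^\Pi_{h,t}(A_h).$$ With $\log^*\omega=\log\log\omega$ put $$R_h^+(q,\omega)=2[q+\log n_h+\log\omega]-\log\bigl[4\pi(q+\log n_h+\log\omega)\bigr]+\log^*\omega .$$ **Theorem.** Let $\mathbf A=\mathbf A^{(\omega)}=(A_h)_{h\in\mathcal H}$ be any nonnegative amplitudes, which may depend on $\omega$. (i) If for some $x\in\mathbb R$ and $\epsilon>0$ $$\lim_{\omega\to\infty}\frac1{\log^*\omega}\,\mathbf E_{\bar\pi^{\omega,\nu}}\Bigl[\Bigl(\frac{A_h}{\sigma_h}-x\Bigr)^2+\epsilon\log^*\omega-R_h^+(q_\alpha^\varkappa,\omega)\Bigr]_+=0,$$ then $\displaystyle\liminf_{\omega\to\infty}\bar\beta^{\Pi}_{\bar\pi^{\omega,\nu}}(\mathbf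 A)\ge(1-\alpha)\,[1-\Phi(x)]$. (ii) If for some $\epsilon>0$ $$\lim_{\omega\to\infty}\frac1{\log^*\omega}\,\mathbf E_{\bar\pi^{\omega,\nu}}\Bigl[R_h^+(q_\alpha^\varkappa,\omega)+2\sqrt{\epsilon\log^*\omega}\,\frac{A_h}{\sigma_h}-\frac{A_h^2}{\sigma_h^2}\Bigr]_+=0,$$ then $\displaystyle\lim_{\omega\to\infty}\bar\beta^{\Pi}_{\bar\pi^{\omega,\nu}}(\mathbf A)=0$. -/

import Mathlib

open MeasureTheory ProbabilityTheory Filter Topology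
open scoped ENNReal

noncomputable section

namespace MonotonicityTest

/-! ### Dyadic bandwidths and grids

The bandwidths `h ∈ {1/2, 1/4, 1/8, …}` are enumerated by `j : ℕ` through `h = 2^{-(j+1)}`.
The grid `{h, 3h, …, 1 - h}` of the bandwidth `h` has `n_h = 1/(2h) = 2^j` points, and the element
`i : Fin (2 ^ j)` stands for the grid point `t = (2 i + 1) h`. -/

/-- The set of all pairs `(h, t)` of a dyadic bandwidth and a point of its grid. -/
abbrev Loc : Type := Σ j : ℕ, Fin (2 ^ j)

/-- The bandwidth `h = 2^{-(j+1)}`. -/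
def bandwidth (j : ℕ) : ℝ := (1 / 2) ^ (j + 1)

/-- The number of grid points `n_h = 1 / (2h)`. -/
def gridSize (j : ℕ) : ℝ := 1 / (2 * bandwidth j)

/-- The resolution level `log₂ (1/h) ∈ {1, 2, 3, …}`. -/
def level (j : ℕ) : ℝ := Real.logb 2 (1 / bandwidth j)

theorem gridSize_eq (j : ℕ) : gridSize j = Fintype.card (Fin (2 ^ j)) := by
  have h : (2 : ℝ) ^ j ≠ 0 := by positivity
  simp only [gridSize, bandwidth, pow_succ, Fintype.card_fin]
  push_cast
  field_simp
  simp

theorem level_eq (j : ℕ) : level j = j + 1 := by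
  have h : (1 / bandwidth j : ℝ) = (2 : ℝ) ^ (j + 1) := by simp [bandwidth]
  rw [level, h, Real.logb_pow, Real.logb_self_eq_one one_lt_two]
  push_cast
  ring

/-- The noise level `σ_h = σ √(2/h)`. -/
def noiseLevel (σ : ℝ) (j : ℕ) : ℝ := σ * √(2 / bandwidth j)

/-! ### The observations -/

/-- The law of a family `ξ = (ξ_{h,t})` of independent standard Gaussian variables. -/
def noiseLaw : Measure (Loc → ℝ) := Measure.infinitePi fun _ : Loc => gaussianReal 0 1

/-- `P_Θ`: the law of the observations `θ̂_{h,t} = θ_{h,t} + σ_h ξ_{h,t}`. -/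
def obsLaw (σ : ℝ) (θ : Loc → ℝ) : Measure (Loc → ℝ) :=
  noiseLaw.map fun ξ p => θ p + noiseLevel σ p.1 * ξ p

/-- `Θ_{ρ,τ}(A)`: the entry at the position `p = (ρ, τ)` is `-A`, all others are nonnegative. -/
def alternatives (p : Loc) (A : ℝ) : Set (Loc → ℝ) :=
  {θ | θ p = -A ∧ ∀ p', p' ≠ p → 0 ≤ θ p'}

/-! ### The adaptive MAP test -/

/-- The standard Gaussian distribution function. -/
def stdPhi (x : ℝ) : ℝ := cdf (gaussianReal 0 1) x

/-- `S(x) = 1/Φ(x) - 1`. -/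
def S (x : ℝ) : ℝ := 1 / stdPhi x - 1

/-- `ψ_0(x) = 1 + log x` and `ψ_l(x) = ψ_0(ψ_{l-1}(x))`. -/
def psi : ℕ → ℝ → ℝ
  | 0, x => 1 + Real.log x
  | l + 1, x => 1 + Real.log (psi l x)

/-- The prior-free weights `Π_h = ψ_m(log₂(1/h))^{-ε} - ψ_m(log₂(1/h) + 1)^{-ε}`. -/
def adaptiveWeight (m : ℕ) (ε : ℝ) (j : ℕ) : ℝ :=
  1 / psi m (level j) ^ ε - 1 / psi m (level j + 1) ^ ε

/-- `Z_h^M = max_t log [S(θ̂_{h,t} / σ_h) / n_h]`. -/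
def levelStat (σ : ℝ) (y : Loc → ℝ) (j : ℕ) : ℝ :=
  ⨆ i : Fin (2 ^ j), Real.log (1 / gridSize j * S (y ⟨j, i⟩ / noiseLevel σ j))

/-- The test statistic `sup_h {Z_h^M + log Π_h}`, which may be infinite. -/
def mapStat (m : ℕ) (ε σ : ℝ) (y : Loc → ℝ) : EReal :=
  ⨆ j : ℕ, ((levelStat σ y j + Real.log (adaptiveWeight m ε j) : ℝ) : EReal)

/-- `q_α = -log log (1/(1-α))`, the `α`-value of `log (1/ϰ)` for a standard exponential `ϰ`. -/
def critLevel (α : ℝ) : ℝ := -Real.log (Real.log (1 / (1 - α)))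

/-- The type II error probability `β_{ρ,τ}(A)` at the position `p = (ρ, τ)`. -/
def typeII (m : ℕ) (ε σ α : ℝ) (p : Loc) (A : ℝ) : ℝ≥0∞ :=
  ⨆ θ ∈ alternatives p A, obsLaw σ θ {y | mapStat m ε σ y ≤ (critLevel α : EReal)}

/-! ### The prior distributions -/

/-- Probability densities `ν` on `(0, ∞)` that are admitted as shapes of a prior. -/
structure IsPriorShape (ν : ℝ → ℝ) : Prop where
  nonneg : ∀ x, 0 < x → 0 ≤ ν x
  bounded : ∃ M, ∀ x, 0 < x → ν x ≤ M
  /-- Continuity, up to a null set, so that the uniform density on `[0, 1]` is included. -/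
  continuous : ∀ᵐ x ∂(volume.restrict (Set.Ioi (0 : ℝ))), ContinuousAt ν x
  integral_eq_one : ∫ x in Set.Ioi (0 : ℝ), ν x = 1
  /-- The differential entropy is finite. -/
  entropy : IntegrableOn (fun x => ν x * Real.log (1 / ν x)) (Set.Ioi 0)
  log_moment : IntegrableOn (fun x => ν x * Real.log (x + 1)) (Set.Ioi 0)
  /-- The normalization of the discretized density is asymptotically `ω`; in particular the
  normalizing sum is finite for all large `ω` (a divergent real series has `∑'` equal to `0`). -/
  riemann_sum : Tendsto (fun ω : ℝ => 1 / ω * ∑' k : ℕ, ν (((k : ℝ) + 1) / ω)) atTop (𝓝 1)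

/-- The prior `π̄_h = ν(log₂(1/h)/ω) / ∑_{k ≥ 1} ν(k/ω)` on the bandwidths. -/
def prior (ν : ℝ → ℝ) (ω : ℝ) (j : ℕ) : ℝ :=
  ν (level j / ω) / ∑' k : ℕ, ν (((k : ℝ) + 1) / ω)

/-- The expectation `E_π̄ [f(h)]_+` of the positive part of `f`, possibly infinite. -/
def expectPos (ν : ℝ → ℝ) (ω : ℝ) (f : ℕ → ℝ) : ℝ≥0∞ :=
  ∑' j : ℕ, ENNReal.ofReal (prior ν ω j) * ENNReal.ofReal (max (f j) 0)

/-- The average type II error probability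
`∑_h (π̄_h / n_h) ∑_t β_{h,t}(A_h)` for the amplitudes `A = (A_h)`. -/
def avgTypeII (m : ℕ) (ε σ α : ℝ) (ν : ℝ → ℝ) (ω : ℝ) (A : ℕ → ℝ) : ℝ≥0∞ :=
  ∑' j : ℕ, ENNReal.ofReal (prior ν ω j / gridSize j) *
    ∑ i : Fin (2 ^ j), typeII m ε σ α ⟨j, i⟩ (A j)

/-! ### The critical signal/noise ratio -/

/-- `log* x = log log x`. -/
def logStar (x : ℝ) : ℝ := Real.log (Real.log x)

/-- `R̃_h(q, ω) = 2 (q + log n_h + log ω) - log [4π (q + log n_h + log ω)]`. -/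
def Rtilde (q ω : ℝ) (j : ℕ) : ℝ :=
  2 * (q + Real.log (gridSize j) + Real.log ω) -
    Real.log (4 * Real.pi * (q + Real.log (gridSize j) + Real.log ω))

/-- `R⁺_h(q, ω) = R̃_h(q, ω) + log* ω`. -/
def Rplus (q ω : ℝ) (j : ℕ) : ℝ := Rtilde q ω j + logStar ω

end MonotonicityTest

end

open MonotonicityTest

namespace MonotonicityTest

/-! By independence the acceptance probability is a product over locations. The coordinate at
`(h,t)` passes iff `Φ(θ̂/σ_h) ≥ 1/(1+s)` with `s = n_h e^q / Π_h`.

Keeping only the factor at `p` bounds the type II error from above (`typeII_le`). Conversely, the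
factors at the other locations are at least `exp(-1/s)`, and the `1/s` add up to at most `e^{-q}`
because `∑ Π_h ≤ 1`; so together they cost at most the factor `exp(-e^{-q}) = 1-α` (`le_typeII`).
What remains is a single Gaussian coordinate, whose `1/(1+s)`-quantile is `-√(2 log s) + o(1)`.

`Π_h` decays at most polynomially in the level, so `log(1/Π_h)` is logarithmic in `j`. On levels `j
≥ κω` the terms of `R⁺` beyond `2(q + log n_h)` are logarithmic in `j` as well. Both `R⁺` and `2 log
s` are at least of order `j`, so their square roots differ by `o(1)` (`eventually_Rplus_approx`).

A bounded `ν` gives levels below `κω` little mass, and Markov's inequality makes the hypothesis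
pointwise with error `δ log* ω` elsewhere (`exists_tsum_prior_atypical_le`). In (i) this yields
`A_h/σ_h - √R⁺ ≤ x`, in (ii) `A_h/σ_h - √R⁺ ≥ √(δ log* ω) → ∞`. -/

/-! ### The Gaussian distribution function and its tails. -/

instance isOpenPosMeasure_gaussianReal : (gaussianReal 0 1).IsOpenPosMeasure :=
  (gaussianReal_absolutelyContinuous' 0 one_ne_zero).isOpenPosMeasure

instance nullSingletonClass_stdGaussian : NullSingletonClass (gaussianReal 0 1) :=
  nullSingletonClass_gaussianReal one_ne_zero

theorem stdPhi_mono : Monotone stdPhi := monotone_cdf _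

theorem stdPhi_pos (x : ℝ) : 0 < stdPhi x := by
  have h : 0 < gaussianReal 0 1 (Set.Iio x) := isOpen_Iio.measure_pos _ Set.nonempty_Iio
  rw [stdPhi, ← ENNReal.ofReal_pos, ofReal_cdf]
  exact h.trans_le (measure_mono Set.Iio_subset_Iic_self)

theorem ofReal_one_sub_stdPhi (x : ℝ) :
    ENNReal.ofReal (1 - stdPhi x) = gaussianReal 0 1 (Set.Ici x) := by
  have h : gaussianReal 0 1 (Set.Ici x) = gaussianReal 0 1 (Set.Ioi x) :=
    (measure_congr Ioi_ae_eq_Ici).symm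
  rw [h, ← Set.compl_Iic, prob_compl_eq_one_sub measurableSet_Iic,
    ENNReal.ofReal_sub _ (stdPhi_pos x).le, stdPhi, ofReal_cdf, ENNReal.ofReal_one]

theorem stdPhi_lt_one (x : ℝ) : stdPhi x < 1 := by
  have h : 0 < gaussianReal 0 1 (Set.Ioi x) := isOpen_Ioi.measure_pos _ Set.nonempty_Ioi
  have h2 := h.trans_le (measure_mono Set.Ioi_subset_Ici_self)
  rw [← ofReal_one_sub_stdPhi, ENNReal.ofReal_pos] at h2
  linarith

theorem measurable_stdPhi : Measurable stdPhi := stdPhi_mono.measurable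

theorem continuousWithinAt_stdPhi (x : ℝ) : ContinuousWithinAt stdPhi (Set.Ici x) x :=
  (cdf (gaussianReal 0 1)).right_continuous x

/-- Chernoff bound for the lower Gaussian tail. -/
theorem stdPhi_neg_le (z : ℝ) (hz : 0 ≤ z) : stdPhi (-z) ≤ Real.exp (-z ^ 2 / 2) := by
  have h := measure_le_le_exp_mul_mgf (μ := gaussianReal 0 1) (X := id) (t := -z) (-z)
    (by linarith) (integrable_exp_mul_gaussianReal _)
  rw [mgf_id_gaussianReal, ← Real.exp_add] at h
  rw [stdPhi, cdf_eq_real]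
  have e : -z ^ 2 / 2 = - -z * -z + (0 * -z + ((1 : NNReal) : ℝ) * (-z) ^ 2 / 2) := by
    rw [NNReal.coe_one]
    ring
  rw [e]
  exact h

/-- Lower bound for the lower Gaussian tail. -/
theorem le_stdPhi_neg (z η : ℝ) (hz : 0 ≤ z) (hη : 0 ≤ η) :
    η * ((√(2 * Real.pi))⁻¹ * Real.exp (-(z + η) ^ 2 / 2)) ≤ stdPhi (-z) := by
  -- On this interval of length `η` the density is smallest at the left end.
  have hsub : Set.Icc (-(z + η)) (-z) ⊆ Set.Iic (-z) := fun y hy => hy.2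
  have hvol : volume.real (Set.Icc (-(z + η)) (-z)) = η := by
    rw [Real.volume_real_Icc_of_le (by linarith)]
    ring
  have hle : gaussianReal 0 1 (Set.Icc (-(z + η)) (-z)) ≤ ENNReal.ofReal (stdPhi (-z)) := by
    rw [stdPhi, ofReal_cdf]
    exact measure_mono hsub
  rw [gaussianReal_apply_eq_integral _ one_ne_zero,
    ENNReal.ofReal_le_ofReal_iff (stdPhi_pos _).le] at hle
  refine le_trans ?_ hle
  have hc := setIntegral_mono_on (μ := volume) (s := Set.Icc (-(z + η)) (-z))
    (f := fun _ => (√(2 * Real.pi))⁻¹ * Real.exp (-(z + η) ^ 2 / 2))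
    (g := gaussianPDFReal 0 1) (integrableOn_const (by simp)) (integrable_gaussianPDFReal _ _).integrableOn
    measurableSet_Icc ?_
  · rwa [setIntegral_const, hvol, smul_eq_mul] at hc
  · intro y hy
    simp only [gaussianPDFReal, NNReal.coe_one, mul_one, sub_zero]
    have hy2 : y ^ 2 ≤ (z + η) ^ 2 := sq_le_sq' hy.1 (by linarith [hy.2])
    gcongr

/-- Half of the probability integral transform. By inner regularity a compact subset suffices; its
greatest element `x` satisfies `Φ(x) < u`, and the subset lies in `(-∞, x]`. -/
theorem gaussianReal_stdPhi_lt_le (u : ℝ) :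
    gaussianReal 0 1 {x | stdPhi x < u} ≤ ENNReal.ofReal u := by
  refine le_of_forall_lt fun r hr => ?_
  obtain ⟨K, hK, hKc, hrK⟩ :=
    (measurableSet_lt measurable_stdPhi measurable_const).exists_lt_isCompact hr
  have hne : K.Nonempty := by
    by_contra h
    simp [Set.not_nonempty_iff_eq_empty.1 h] at hrK
  obtain ⟨x, hx, hmax⟩ := hKc.exists_isGreatest hne
  have hKx : K ⊆ Set.Iic x := fun y hy => hmax hy
  refine hrK.trans_le ((measure_mono hKx).trans ?_)
  rw [← ofReal_cdf]
  exact ENNReal.ofReal_le_ofReal (hK hx).le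

theorem one_sub_le_gaussianReal_le_stdPhi (u : ℝ) (hu : 0 ≤ u) :
    ENNReal.ofReal (1 - u) ≤ gaussianReal 0 1 {x | u ≤ stdPhi x} := by
  have h : {x | u ≤ stdPhi x} = {x | stdPhi x < u}ᶜ := by ext; simp
  rw [h, prob_compl_eq_one_sub (measurableSet_lt measurable_stdPhi measurable_const),
    ENNReal.ofReal_sub _ hu, ENNReal.ofReal_one]
  exact tsub_le_tsub_left (gaussianReal_stdPhi_lt_le u) _

/-! ### The weights `Π_h`. -/

theorem one_le_psi (m : ℕ) {x : ℝ} (hx : 1 ≤ x) : 1 ≤ psi m x := by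
  induction m with
  | zero => simpa [psi] using Real.log_nonneg hx
  | succ l ih => simpa [psi] using Real.log_nonneg ih

theorem psi_one (m : ℕ) : psi m 1 = 1 := by
  induction m with
  | zero => simp [psi]
  | succ l ih => simp [psi, ih]

theorem psi_le_self (m : ℕ) {x : ℝ} (hx : 1 ≤ x) : psi m x ≤ x := by
  induction m with
  | zero => simpa [psi, add_comm] using add_le_add_left (Real.log_le_sub_one_of_pos (by linarith : 0 < x)) 1
  | succ l ih =>
    have := Real.log_le_sub_one_of_pos (by linarith [one_le_psi l hx] : 0 < psi l x)
    simp only [psi]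
    linarith

theorem div_le_log_sub_log {a b : ℝ} (ha : 0 < a) (hb : 0 < b) :
    (b - a) / b ≤ Real.log b - Real.log a := by
  have h := Real.one_sub_inv_le_log_of_pos (div_pos hb ha)
  rw [Real.log_div hb.ne' ha.ne', inv_div] at h
  rwa [sub_div, div_self hb.ne']

/-- Increments of `ψ_m` decay at most polynomially. -/
theorem le_psi_add_one_sub (m : ℕ) {x : ℝ} (hx : 1 ≤ x) :
    (1 / (x + 1)) ^ (m + 1) ≤ psi m (x + 1) - psi m x := by
  induction m with
  | zero =>
    have := div_le_log_sub_log (a := x) (b := x + 1) (by linarith) (by linarith)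
    simp only [psi, zero_add, pow_one]
    rw [add_sub_cancel_left] at this
    linarith
  | succ l ih =>
    have h1 := one_le_psi l hx
    have h2 := one_le_psi l (by linarith : 1 ≤ x + 1)
    have h3 := div_le_log_sub_log (a := psi l x) (b := psi l (x + 1)) (by linarith) (by linarith)
    simp only [psi]
    -- Each further logarithm divides the increment by at most `ψ_l(x+1) ≤ x+1`.
    have h4 : (1 / (x + 1)) ^ (l + 1 + 1) ≤ (psi l (x + 1) - psi l x) / psi l (x + 1) := by
      rw [pow_succ, div_eq_mul_one_div (_ - _)]
      have hx1 : 0 ≤ 1 / (x + 1) := by positivity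
      exact mul_le_mul ih (one_div_le_one_div_of_le (by linarith) (psi_le_self l (by linarith)))
        hx1 ((pow_nonneg hx1 _).trans ih)
    linarith

theorem one_le_level (j : ℕ) : 1 ≤ level j := by
  rw [level_eq]
  linarith [Nat.cast_nonneg (α := ℝ) j]

theorem gridSize_eq_two_pow (j : ℕ) : gridSize j = 2 ^ j := by
  rw [gridSize_eq]
  simp

/-- The weights decay at most polynomially in the resolution level. -/
theorem le_adaptiveWeight (m : ℕ) {ε : ℝ} (hε0 : 0 < ε) (hε1 : ε < 1) (j : ℕ) :
    ε * (1 / ((j : ℝ) + 2)) ^ (m + 3) ≤ adaptiveWeight m ε j := by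
  have h1 := one_le_psi m (one_le_level j)
  have hl : (1 : ℝ) ≤ level j + 1 := by linarith [one_le_level j]
  have h2 := one_le_psi m hl
  have h3 := psi_le_self m hl
  have h4 := le_psi_add_one_sub m (one_le_level j)
  have hj : (j : ℝ) + 2 = level j + 1 := by rw [level_eq]; ring
  rw [adaptiveWeight, hj]
  set k := level j + 1
  set u := psi m (level j)
  set v := psi m k
  have hu : 0 < u := by linarith
  have hv : 0 < v := by linarith
  have hk : 0 < k := by linarith
  have h5 := div_le_log_sub_log hu hv
  -- The weight is `v^{-ε} (exp(ε (log v - log u)) - 1)`, bounded below by linearizing the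
  -- exponential. The exponent `m + 3` collects `m + 1` from the increment of `ψ_m`, one from `1/v`
  -- and one from `v^{-ε}`.
  have e1 : 1 / u ^ ε = 1 / v ^ ε * Real.exp (ε * (Real.log v - Real.log u)) := by
    rw [Real.rpow_def_of_pos hu, Real.rpow_def_of_pos hv, one_div, one_div, ← Real.exp_neg,
      ← Real.exp_neg, ← Real.exp_add]
    congr 1
    ring
  have h6 := Real.add_one_le_exp (ε * (Real.log v - Real.log u))
  have h7 : 1 / k ≤ 1 / v := one_div_le_one_div_of_le hv h3
  have h8 : 1 / k ≤ 1 / v ^ ε := h7.trans (one_div_le_one_div_of_le (by positivity)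
    (Real.rpow_le_self_of_one_le h2 hε1.le))
  have hk0 : 0 ≤ 1 / k := by positivity
  have h9 : (1 / k) ^ (m + 2) ≤ (v - u) / v := by
    rw [pow_succ, div_eq_mul_one_div (_ - _)]
    exact mul_le_mul h4 h7 hk0 ((pow_nonneg hk0 _).trans h4)
  calc ε * (1 / k) ^ (m + 3) = (1 / k) * (ε * (1 / k) ^ (m + 2)) := by ring
    _ ≤ (1 / v ^ ε) * (ε * (Real.log v - Real.log u)) := by
        refine mul_le_mul h8 (mul_le_mul_of_nonneg_left (h9.trans h5) hε0.le) ?_ (by positivity)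
        positivity
    _ ≤ (1 / v ^ ε) * (Real.exp (ε * (Real.log v - Real.log u)) - 1) := by
        gcongr
        linarith
    _ = 1 / u ^ ε - 1 / v ^ ε := by rw [e1]; ring

theorem adaptiveWeight_pos (m : ℕ) {ε : ℝ} (hε0 : 0 < ε) (hε1 : ε < 1) (j : ℕ) :
    0 < adaptiveWeight m ε j :=
  lt_of_lt_of_le (by positivity) (le_adaptiveWeight m hε0 hε1 j)

/-- The sum telescopes, and its first term is `1` because the levels start at `1`, where `ψ_m = 1`.
-/
theorem sum_adaptiveWeight_le_one (m : ℕ) (ε : ℝ) (N : ℕ) :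
    ∑ j ∈ Finset.range N, adaptiveWeight m ε j ≤ 1 := by
  have h : ∀ j, adaptiveWeight m ε j =
      1 / psi m ((j : ℝ) + 1) ^ ε - 1 / psi m (((j + 1 : ℕ) : ℝ) + 1) ^ ε := by
    intro j
    simp [adaptiveWeight, level_eq]
  simp_rw [h]
  rw [Finset.sum_range_sub' (fun j : ℕ => 1 / psi m ((j : ℝ) + 1) ^ ε)]
  have h1 := one_le_psi m (by linarith [Nat.cast_nonneg (α := ℝ) N] : (1 : ℝ) ≤ (N : ℝ) + 1)
  have : 0 ≤ 1 / psi m ((N : ℝ) + 1) ^ ε := by positivity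
  simp [psi_one] at this ⊢
  exact this

theorem adaptiveWeight_le_one (m : ℕ) {ε : ℝ} (hε0 : 0 < ε) (hε1 : ε < 1) (j : ℕ) :
    adaptiveWeight m ε j ≤ 1 :=
  (Finset.single_le_sum (f := adaptiveWeight m ε)
    (fun i _ => (adaptiveWeight_pos m hε0 hε1 i).le) (Finset.self_mem_range_succ j)).trans
    (sum_adaptiveWeight_le_one m ε (j + 1))

/-- A finite set of locations lies in finitely many full grids, and a full grid with its `n_h`
points contributes exactly `Π_h`. -/
theorem sum_adaptiveWeight_div_gridSize_le_one (m : ℕ) {ε : ℝ} (hε0 : 0 < ε) (hε1 : ε < 1)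
    (T : Finset Loc) : ∑ p ∈ T, adaptiveWeight m ε p.1 / gridSize p.1 ≤ 1 := by
  obtain ⟨N, hN⟩ := (T.image Sigma.fst).exists_nat_subset_range
  have hT : T ⊆ (Finset.range N).sigma fun _ => Finset.univ := by
    intro p hp
    simp only [Finset.mem_sigma, Finset.mem_univ, and_true]
    exact hN (Finset.mem_image_of_mem _ hp)
  refine (Finset.sum_le_sum_of_subset_of_nonneg hT fun p _ _ => ?_).trans ?_
  · have := adaptiveWeight_pos m hε0 hε1 p.1
    rw [gridSize_eq_two_pow]
    positivity
  · rw [Finset.sum_sigma]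
    refine le_trans (le_of_eq (Finset.sum_congr rfl fun j _ => ?_))
      (sum_adaptiveWeight_le_one m ε N)
    simp only [gridSize_eq_two_pow]
    simp
    field_simp

/-! ### Acceptance probability and type II error of a single location. -/

/-- The test accepts iff `S(θ̂_{h,t} / σ_h)` is at most this threshold for all `(h, t)`. -/
noncomputable def threshold (m : ℕ) (ε q : ℝ) (j : ℕ) : ℝ :=
  gridSize j * Real.exp q / adaptiveWeight m ε j

theorem threshold_pos (m : ℕ) {ε : ℝ} (hε0 : 0 < ε) (hε1 : ε < 1) (q : ℝ) (j : ℕ) :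
    0 < threshold m ε q j := by
  have := adaptiveWeight_pos m hε0 hε1 j
  rw [threshold, gridSize_eq_two_pow]
  positivity

theorem noiseLevel_pos {σ : ℝ} (hσ : 0 < σ) (j : ℕ) : 0 < noiseLevel σ j := by
  have : 0 < bandwidth j := by unfold bandwidth; positivity
  unfold noiseLevel
  positivity

theorem S_pos (x : ℝ) : 0 < S x := by
  rw [S, sub_pos, lt_div_iff₀ (stdPhi_pos x)]
  simpa using stdPhi_lt_one x

theorem S_le_iff {x s : ℝ} (hs : 0 < s) : S x ≤ s ↔ 1 / (1 + s) ≤ stdPhi x := by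
  rw [S, sub_le_iff_le_add, div_le_iff₀ (stdPhi_pos x), div_le_iff₀ (by linarith), add_comm s,
    mul_comm]

/-- Acceptance decouples into one condition per location, which is what lets independence turn it
into a product. -/
theorem mapStat_le_iff (m : ℕ) {ε : ℝ} (hε0 : 0 < ε) (hε1 : ε < 1) (σ q : ℝ) (y : Loc → ℝ) :
    mapStat m ε σ y ≤ (q : EReal) ↔
      ∀ p : Loc, 1 / (1 + threshold m ε q p.1) ≤ stdPhi (y p / noiseLevel σ p.1) := by
  rw [mapStat, iSup_le_iff, Sigma.forall]
  refine forall_congr' fun j => ?_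
  rw [EReal.coe_le_coe_iff, ← le_sub_iff_add_le, levelStat, ciSup_le_iff (Set.finite_range _).bddAbove]
  refine forall_congr' fun i => ?_
  have hw := adaptiveWeight_pos m hε0 hε1 j
  have hS := S_pos (y ⟨j, i⟩ / noiseLevel σ j)
  have hg : 0 < gridSize j := by rw [gridSize_eq_two_pow]; positivity
  rw [← S_le_iff (threshold_pos m hε0 hε1 q j), Real.log_le_iff_le_exp (by positivity),
    Real.exp_sub, Real.exp_log hw, threshold, mul_div_assoc, one_div, inv_mul_le_iff₀ hg]

/-- The acceptance region of the test, in terms of the noise. -/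
theorem obsLaw_mapStat_le (m : ℕ) {ε : ℝ} (hε0 : 0 < ε) (hε1 : ε < 1) {σ : ℝ} (hσ : 0 < σ) (q : ℝ)
    (θ : Loc → ℝ) :
    obsLaw σ θ {y | mapStat m ε σ y ≤ (q : EReal)} =
      ∏' p : Loc, gaussianReal 0 1
        {x | 1 / (1 + threshold m ε q p.1) ≤ stdPhi (θ p / noiseLevel σ p.1 + x)} := by
  have hmeas : ∀ p : Loc, MeasurableSet
      {x | 1 / (1 + threshold m ε q p.1) ≤ stdPhi (θ p / noiseLevel σ p.1 + x)} := fun p =>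
    measurableSet_le measurable_const (measurable_stdPhi.comp (measurable_const.add measurable_id))
  have hset : {y : Loc → ℝ | mapStat m ε σ y ≤ (q : EReal)} =
      ⋂ p : Loc, {y | 1 / (1 + threshold m ε q p.1) ≤ stdPhi (y p / noiseLevel σ p.1)} := by
    ext y
    simp only [Set.mem_ofPred_eq, Set.mem_iInter]
    exact mapStat_le_iff m hε0 hε1 σ q y
  rw [← Measure.infinitePi_pi_univ _ hmeas, obsLaw, Measure.map_apply (by fun_prop), noiseLaw]
  · congr 1
    rw [hset]
    ext ξ
    simp only [Set.mem_preimage, Set.mem_iInter, Set.mem_ofPred_eq, Set.mem_pi, Set.mem_univ,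
      true_imp_iff]
    refine forall_congr' fun p => ?_
    rw [add_div, mul_div_cancel_left₀ _ (noiseLevel_pos hσ p.1).ne']
  · rw [hset]
    exact MeasurableSet.iInter fun p => measurableSet_le measurable_const
      (measurable_stdPhi.comp ((measurable_pi_apply p).div_const _))

/-- Under the null hypothesis a single coordinate stays below its threshold with the probability
`exp (-1 / s)` at least, for the threshold `s`. -/
theorem exp_neg_le_gaussianReal (m : ℕ) {ε : ℝ} (hε0 : 0 < ε) (hε1 : ε < 1) (q : ℝ) (j : ℕ) :
    ENNReal.ofReal (Real.exp (-(Real.exp (-q) * (adaptiveWeight m ε j / gridSize j)))) ≤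
      gaussianReal 0 1 {x | 1 / (1 + threshold m ε q j) ≤ stdPhi x} := by
  have hs := threshold_pos m hε0 hε1 q j
  refine le_trans (ENNReal.ofReal_le_ofReal ?_)
    (one_sub_le_gaussianReal_le_stdPhi _ (by positivity))
  have h1 : Real.exp (-q) * (adaptiveWeight m ε j / gridSize j) = 1 / threshold m ε q j := by
    rw [threshold, Real.exp_neg, one_div_div]
    field_simp
  rw [h1, Real.exp_neg]
  have h2 : 1 - 1 / (1 + threshold m ε q j) = (1 / threshold m ε q j + 1)⁻¹ := by
    field_simp
    ring
  rw [h2]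
  exact inv_anti₀ (by positivity) (Real.add_one_le_exp _)

/-- The type II error is at least the one of the single coordinate `p`, up to the factor
`exp (-exp (-q))`. -/
theorem le_obsLaw_mapStat_le (m : ℕ) {ε : ℝ} (hε0 : 0 < ε) (hε1 : ε < 1) {σ : ℝ} (hσ : 0 < σ)
    (q : ℝ) (p : Loc) (θ : Loc → ℝ) (hθ : ∀ p', p' ≠ p → 0 ≤ θ p') :
    gaussianReal 0 1 {x | 1 / (1 + threshold m ε q p.1) ≤ stdPhi (θ p / noiseLevel σ p.1 + x)} *
      ENNReal.ofReal (Real.exp (-Real.exp (-q))) ≤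
      obsLaw σ θ {y | mapStat m ε σ y ≤ (q : EReal)} := by
  classical
  rw [obsLaw_mapStat_le m hε0 hε1 hσ, ENNReal.tprod_eq_iInf_prod fun _ => prob_le_one]
  refine le_iInf fun T => ?_
  -- The infinite product is the infimum of its finite subproducts; adjoining `p` to the index set
  -- only decreases them.
  refine le_trans ?_ (Finset.prod_le_prod_of_subset_of_le_one' (Finset.subset_insert p T)
    fun _ _ _ => prob_le_one)
  rw [← Finset.mul_prod_erase (insert p T) _ (Finset.mem_insert_self p T)]
  generalize insert p T = T
  refine mul_le_mul_right ?_ _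
  calc ENNReal.ofReal (Real.exp (-Real.exp (-q)))
      ≤ ENNReal.ofReal (Real.exp (∑ p' ∈ T.erase p,
          -(Real.exp (-q) * (adaptiveWeight m ε p'.1 / gridSize p'.1)))) := by
        apply ENNReal.ofReal_le_ofReal
        apply Real.exp_le_exp.2
        rw [Finset.sum_neg_distrib, ← Finset.mul_sum, neg_le_neg_iff]
        exact mul_le_of_le_one_right (Real.exp_pos _).le
          (sum_adaptiveWeight_div_gridSize_le_one m hε0 hε1 _)
    _ = ∏ p' ∈ T.erase p, ENNReal.ofReal
          (Real.exp (-(Real.exp (-q) * (adaptiveWeight m ε p'.1 / gridSize p'.1)))) := by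
        rw [Real.exp_sum, ENNReal.ofReal_prod_of_nonneg fun _ _ => (Real.exp_pos _).le]
    _ ≤ _ := by
        refine Finset.prod_le_prod' fun p' hp' => ?_
        refine (exp_neg_le_gaussianReal m hε0 hε1 q p'.1).trans (measure_mono fun x hx => ?_)
        have h0 : 0 ≤ θ p' / noiseLevel σ p'.1 :=
          div_nonneg (hθ p' (Finset.ne_of_mem_erase hp')) (noiseLevel_pos hσ _).le
        exact le_trans hx (stdPhi_mono (by linarith))

/-- The critical level is the `(1-α)`-quantile of the Gumbel law; this is the source of the factor
`1-α`. -/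
theorem exp_neg_exp_neg_critLevel {α : ℝ} (hα0 : 0 < α) (hα1 : α < 1) :
    Real.exp (-Real.exp (-critLevel α)) = 1 - α := by
  have h : 0 < 1 - α := by linarith
  have h2 : 0 < Real.log (1 / (1 - α)) := Real.log_pos (by rw [lt_div_iff₀ h]; linarith)
  rw [critLevel, neg_neg, Real.exp_log h2, one_div, Real.log_inv, neg_neg, Real.exp_log h]

/-- Lower bound for the type II error, if `-z` is not below the quantile of the threshold. -/
theorem le_typeII (m : ℕ) {ε : ℝ} (hε0 : 0 < ε) (hε1 : ε < 1) {σ : ℝ} (hσ : 0 < σ) {α : ℝ}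
    (hα0 : 0 < α) (hα1 : α < 1) (p : Loc) (A z : ℝ)
    (hz : 1 / (1 + threshold m ε (critLevel α) p.1) ≤ stdPhi (-z)) :
    ENNReal.ofReal ((1 - α) * (1 - stdPhi (A / noiseLevel σ p.1 - z))) ≤
      typeII m ε σ α p A := by
  classical
  let θ : Loc → ℝ := Function.update 0 p (-A)
  have hθ0 : ∀ p', p' ≠ p → 0 ≤ θ p' := fun p' hp' => by simp [θ, Function.update_of_ne hp']
  have hθp : θ p = -A := by simp [θ]
  have hmem : θ ∈ alternatives p A := ⟨hθp, hθ0⟩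
  refine le_trans ?_ (le_iSup₂_of_le θ hmem le_rfl)
  refine le_trans ?_ (le_obsLaw_mapStat_le m hε0 hε1 hσ _ p θ hθ0)
  rw [exp_neg_exp_neg_critLevel hα0 hα1, mul_comm,
    ENNReal.ofReal_mul (by linarith [stdPhi_lt_one (A / noiseLevel σ p.1 - z)]),
    ofReal_one_sub_stdPhi, hθp]
  refine mul_le_mul_left (measure_mono fun x hx => hz.trans (stdPhi_mono ?_)) _
  rw [Set.mem_Ici] at hx
  rw [neg_div]
  linarith

/-- Upper bound for the type II error, if `-z` is below the quantile of the threshold. -/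
theorem typeII_le (m : ℕ) {ε : ℝ} (hε0 : 0 < ε) (hε1 : ε < 1) {σ : ℝ} (hσ : 0 < σ) (α : ℝ)
    (p : Loc) (A z : ℝ)
    (hz : stdPhi (-z) < 1 / (1 + threshold m ε (critLevel α) p.1)) :
    typeII m ε σ α p A ≤ ENNReal.ofReal (1 - stdPhi (A / noiseLevel σ p.1 - z)) := by
  refine iSup₂_le fun θ hθ => ?_
  rw [obsLaw_mapStat_le m hε0 hε1 hσ, ENNReal.tprod_eq_iInf_prod fun _ => prob_le_one]
  -- Only the factor at `p` is kept, so the bound is uniform in all other entries of `θ`.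
  refine (iInf_le _ {p}).trans ?_
  rw [Finset.prod_singleton, ofReal_one_sub_stdPhi, hθ.1]
  refine measure_mono fun x hx => ?_
  rw [Set.mem_Ici]
  by_contra! hlt
  have hle : -A / noiseLevel σ p.1 + x ≤ -z := by
    rw [neg_div]
    linarith
  exact absurd (hz.trans_le hx) (not_lt.2 (stdPhi_mono hle))

/-! ### Asymptotics of the quantile and comparison with `R⁺`. -/

/-- An error of size `c √j` in a radicand of order `j` moves its square root only by a multiple of
`c`; logarithmic errors are therefore negligible. -/
theorem eventually_mul_log_add_le (C D : ℝ) {c : ℝ} (hc : 0 < c) :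
    ∀ᶠ j : ℕ in atTop, C * Real.log ((j : ℝ) + 2) + D ≤ c * √(j : ℝ) := by
  have h1 : (fun x : ℝ => C * Real.log x + D) =o[atTop] fun x : ℝ => x ^ (1 / 2 : ℝ) := by
    refine ((isLittleO_log_rpow_atTop (by norm_num)).const_mul_left C).add ?_
    refine Asymptotics.isLittleO_const_left.2 (Or.inr ?_)
    exact tendsto_norm_atTop_atTop.comp (tendsto_rpow_atTop (by norm_num))
  have h2 := h1.bound (half_pos hc)
  have h3 : Tendsto (fun j : ℕ => (j : ℝ) + 2) atTop atTop :=
    tendsto_atTop_add_const_right _ _ tendsto_natCast_atTop_atTop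
  filter_upwards [h3.eventually h2, eventually_ge_atTop 1] with j hj hj1
  have hj1' : (1 : ℝ) ≤ j := by exact_mod_cast hj1
  rw [← Real.sqrt_eq_rpow, Real.norm_eq_abs, Real.norm_of_nonneg (Real.sqrt_nonneg _)] at hj
  have h4 : √((j : ℝ) + 2) ≤ 2 * √(j : ℝ) := by
    rw [Real.sqrt_le_left (by positivity), mul_pow, Real.sq_sqrt (by positivity)]
    linarith
  nlinarith [le_abs_self (C * Real.log ((j : ℝ) + 2) + D)]

theorem tendsto_sqrt_two_mul : Tendsto (fun t : ℝ => √(2 * t)) atTop atTop :=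
  Real.tendsto_sqrt_atTop.comp (tendsto_id.const_mul_atTop two_pos)

/-- The `1 / (1 + e ^ t)`-quantile is at most `η - √(2 t)` for large `t`. -/
theorem eventually_le_stdPhi {η : ℝ} (hη : 0 < η) :
    ∀ᶠ t : ℝ in atTop, 1 / (1 + Real.exp t) ≤ stdPhi (-(√(2 * t) - η)) := by
  have h1 : Tendsto (fun t : ℝ => η / 2 * (√(2 * Real.pi))⁻¹ *
      Real.exp (η / 2 * √(2 * t) - (η / 2) ^ 2 / 2)) atTop atTop := by
    refine Tendsto.const_mul_atTop (by positivity) (Real.tendsto_exp_atTop.comp ?_)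
    exact tendsto_atTop_add_const_right _ _ (tendsto_sqrt_two_mul.const_mul_atTop (by positivity))
  filter_upwards [h1.eventually_ge_atTop 1, tendsto_sqrt_two_mul.eventually_ge_atTop η,
    eventually_ge_atTop 0] with t ht htη ht0
  -- Half of `η` is the width of the interval; the other half leaves the growing factor `exp(η √(2t)
  -- / 2)`.
  have h2 := le_stdPhi_neg (√(2 * t) - η) (η / 2) (by linarith) (by linarith)
  refine le_trans ?_ h2
  have h3 : Real.exp (-(√(2 * t) - η + η / 2) ^ 2 / 2) =
      Real.exp (η / 2 * √(2 * t) - (η / 2) ^ 2 / 2) * Real.exp (-t) := by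
    rw [← Real.exp_add]
    congr 1
    have := Real.sq_sqrt (by linarith : 0 ≤ 2 * t)
    linear_combination (-1 / 2) * this
  calc 1 / (1 + Real.exp t) ≤ 1 / Real.exp t :=
        one_div_le_one_div_of_le (Real.exp_pos _) (by linarith)
    _ = 1 * Real.exp (-t) := by rw [Real.exp_neg, one_div, one_mul]
    _ ≤ _ := mul_le_mul_of_nonneg_right ht (Real.exp_pos _).le
    _ = _ := by rw [h3]; ring

/-- The `1 / (1 + e ^ t)`-quantile is above `-η - √(2 t)` for large `t`. -/
theorem eventually_stdPhi_lt {η : ℝ} (hη : 0 < η) :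
    ∀ᶠ t : ℝ in atTop, stdPhi (-(√(2 * t) + η)) < 1 / (1 + Real.exp t) := by
  have h1 : Tendsto (fun t : ℝ => Real.exp (η * √(2 * t) + η ^ 2 / 2)) atTop atTop := by
    refine Real.tendsto_exp_atTop.comp ?_
    exact tendsto_atTop_add_const_right _ _ (tendsto_sqrt_two_mul.const_mul_atTop hη)
  -- The constant `2` serves `1 + e^t ≤ 2 e^t` for `t ≥ 0`.
  filter_upwards [h1.eventually_gt_atTop 2, eventually_ge_atTop 0] with t ht ht0
  refine (stdPhi_neg_le _ (by positivity)).trans_lt ?_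
  have h3 : Real.exp (-(√(2 * t) + η) ^ 2 / 2) =
      (Real.exp (η * √(2 * t) + η ^ 2 / 2) * Real.exp t)⁻¹ := by
    rw [← Real.exp_add, ← Real.exp_neg]
    congr 1
    have := Real.sq_sqrt (by linarith : 0 ≤ 2 * t)
    linear_combination (-1 / 2) * this
  rw [h3, one_div]
  have h4 := Real.one_le_exp ht0
  refine inv_strictAnti₀ (by positivity) ?_
  nlinarith

theorem log_threshold (m : ℕ) {ε : ℝ} (hε0 : 0 < ε) (hε1 : ε < 1) (q : ℝ) (j : ℕ) :
    Real.log (threshold m ε q j) = q + j * Real.log 2 - Real.log (adaptiveWeight m ε j) := by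
  rw [threshold, gridSize_eq_two_pow, Real.log_div (by positivity)
    (adaptiveWeight_pos m hε0 hε1 j).ne', Real.log_mul (by positivity) (Real.exp_pos _).ne',
    Real.log_exp, Real.log_pow]
  ring

theorem le_log_threshold (m : ℕ) {ε : ℝ} (hε0 : 0 < ε) (hε1 : ε < 1) (q : ℝ) (j : ℕ) :
    q + j * Real.log 2 ≤ Real.log (threshold m ε q j) := by
  rw [log_threshold m hε0 hε1]
  linarith [Real.log_nonpos (adaptiveWeight_pos m hε0 hε1 j).le (adaptiveWeight_le_one m hε0 hε1 j)]

theorem eventually_log_threshold_le (m : ℕ) {ε : ℝ} (hε0 : 0 < ε) (hε1 : ε < 1) (q : ℝ)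
    {c : ℝ} (hc : 0 < c) :
    ∀ᶠ j : ℕ in atTop,
      Real.log (threshold m ε q j) ≤ q + j * Real.log 2 + c * √(j : ℝ) := by
  filter_upwards [eventually_mul_log_add_le (m + 3) (-Real.log ε) hc] with j hj
  rw [log_threshold m hε0 hε1]
  have h := Real.log_le_log (by positivity) (le_adaptiveWeight m hε0 hε1 j)
  rw [Real.log_mul hε0.ne' (by positivity), Real.log_pow, one_div, Real.log_inv] at h
  push_cast at h
  linarith

theorem tendsto_log_threshold (m : ℕ) {ε : ℝ} (hε0 : 0 < ε) (hε1 : ε < 1) (q : ℝ) :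
    Tendsto (fun j => Real.log (threshold m ε q j)) atTop atTop := by
  refine tendsto_atTop_mono (le_log_threshold m hε0 hε1 q) ?_
  exact tendsto_atTop_add_const_left _ _
    (tendsto_natCast_atTop_atTop.atTop_mul_const (Real.log_pos one_lt_two))

/-- Levels above `κω` leave every bounded range as `ω` grows, so asymptotics in `j` become uniform
over them. -/
theorem eventually_forall_of_eventually {P : ℕ → Prop} (hP : ∀ᶠ j in atTop, P j) {κ : ℝ}
    (hκ : 0 < κ) : ∀ᶠ ω : ℝ in atTop, ∀ j : ℕ, κ * ω < (j : ℝ) + 1 → P j := by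
  obtain ⟨N, hN⟩ := eventually_atTop.1 hP
  filter_upwards [eventually_ge_atTop ((N : ℝ) / κ)] with ω hω j hj
  rw [div_le_iff₀ hκ] at hω
  have : (N : ℝ) < (j + 1 : ℕ) := by push_cast; linarith
  exact hN j (Nat.lt_succ_iff.1 (by exact_mod_cast this))

/-- On bandwidths whose resolution level is at least of the order `ω`, the number of grid points
dominates the critical signal/noise ratio. -/
theorem eventually_abs_Rplus_sub_le (q : ℝ) {κ c : ℝ} (hκ : 0 < κ) (hc : 0 < c) :
    ∀ᶠ ω : ℝ in atTop, ∀ j : ℕ, κ * ω < (j : ℝ) + 1 →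
      |Rplus q ω j - 2 * (q + j * Real.log 2)| ≤ c * √(j : ℝ) := by
  set C : ℝ := |q| + 2 + |Real.log κ|
  have hC : 0 < C := by positivity
  have hq : ∀ᶠ j : ℕ in atTop, 1 ≤ q + (j : ℝ) * Real.log 2 :=
    (tendsto_atTop_add_const_left _ q (tendsto_natCast_atTop_atTop.atTop_mul_const
      (Real.log_pos one_lt_two))).eventually_ge_atTop 1
  -- The upper error is `2 log ω + log* ω ≤ 3 log ω ≤ 3 (log(j+2) - log κ)`. The lower error is the
  -- logarithm of `4π(q + log n_h + log ω) ≤ 4πC(j+2)`.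
  filter_upwards [eventually_forall_of_eventually hq hκ,
    eventually_forall_of_eventually (eventually_mul_log_add_le 3 (-(3 * Real.log κ)) hc) hκ,
    eventually_forall_of_eventually (eventually_mul_log_add_le 1 (Real.log (4 * Real.pi * C)) hc) hκ,
    eventually_ge_atTop (Real.exp 1)] with ω h1 h2 h3 hω j hj
  specialize h1 j hj
  specialize h2 j hj
  specialize h3 j hj
  have hω0 : 0 < ω := (Real.exp_pos 1).trans_le hω
  have hl1 : 1 ≤ Real.log ω := (Real.le_log_iff_exp_le hω0).2 hω
  have hl2 : Real.log ω ≤ Real.log ((j : ℝ) + 2) - Real.log κ := by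
    rw [← Real.log_div (by positivity) hκ.ne']
    refine Real.log_le_log hω0 ?_
    rw [le_div_iff₀ hκ]
    linarith
  have hs0 : 0 ≤ logStar ω := Real.log_nonneg hl1
  have hs1 : logStar ω ≤ Real.log ω := Real.log_le_self (by linarith)
  have hg : Real.log (gridSize j) = j * Real.log 2 := by rw [gridSize_eq_two_pow, Real.log_pow]
  have hlog2 : (j : ℝ) * Real.log 2 ≤ j :=
    mul_le_of_le_one_right j.cast_nonneg (by linarith [Real.log_two_lt_d9])
  have hj2 : Real.log ((j : ℝ) + 2) ≤ j + 2 := Real.log_le_self (by positivity)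
  have hX1 : 1 ≤ q + j * Real.log 2 + Real.log ω := by linarith
  have hXC : q + j * Real.log 2 + Real.log ω ≤ C * (j + 2) := by
    have e1 : |q| * 1 ≤ |q| * (j + 2) := by gcongr; linarith [Nat.cast_nonneg (α := ℝ) j]
    have e2 : |Real.log κ| * 1 ≤ |Real.log κ| * (j + 2) := by
      gcongr; linarith [Nat.cast_nonneg (α := ℝ) j]
    have e3 : C * ((j : ℝ) + 2) = |q| * (j + 2) + 2 * (j + 2) + |Real.log κ| * (j + 2) := by
      simp only [C]; ring
    linarith [le_abs_self q, neg_abs_le (Real.log κ), Nat.cast_nonneg (α := ℝ) j]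
  have hL0 : 0 ≤ Real.log (4 * Real.pi * (q + j * Real.log 2 + Real.log ω)) := by
    refine Real.log_nonneg ?_
    nlinarith [Real.pi_gt_three]
  have hL1 : Real.log (4 * Real.pi * (q + j * Real.log 2 + Real.log ω)) ≤
      Real.log (4 * Real.pi * C) + Real.log ((j : ℝ) + 2) := by
    rw [← Real.log_mul (by positivity) (by positivity), mul_assoc (4 * Real.pi)]
    refine Real.log_le_log (by positivity) ?_
    gcongr
  rw [Rplus, Rtilde, hg, abs_le]
  constructor <;> linarith

/-- The critical value of a single coordinate and the critical signal/noise ratio agree up to a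
small error. -/
theorem eventually_Rplus_approx (m : ℕ) {ε : ℝ} (hε0 : 0 < ε) (hε1 : ε < 1) (q : ℝ) {κ c : ℝ}
    (hκ : 0 < κ) (hc : 0 < c) :
    ∀ᶠ ω : ℝ in atTop, ∀ j : ℕ, κ * ω < (j : ℝ) + 1 →
      √(Rplus q ω j) ≤ √(2 * Real.log (threshold m ε q j)) + c ∧
      √(2 * Real.log (threshold m ε q j)) ≤ √(Rplus q ω j) + c ∧ (j : ℝ) ≤ Rplus q ω j := by
  -- The radicands differ by at most `3d√j`, made of `2d√j` from the threshold and `d√j` from `R⁺`.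
  -- The bound `1/4` keeps `R⁺ ≥ j`.
  set d := min (c / 3) (1 / 4)
  have hd : 0 < d := by positivity
  have hdc : 3 * d ≤ c := by linarith [min_le_left (c / 3) (1 / 4 : ℝ)]
  have hd4 : d ≤ 1 / 4 := min_le_right _ _
  have hq : ∀ᶠ j : ℕ in atTop, -(2 * q) ≤ (1 / 8 : ℝ) * (j : ℝ) :=
    (tendsto_natCast_atTop_atTop.const_mul_atTop (by norm_num)).eventually_ge_atTop _
  filter_upwards [eventually_abs_Rplus_sub_le q hκ hd,
    eventually_forall_of_eventually (eventually_log_threshold_le m hε0 hε1 q hd) hκ,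
    eventually_forall_of_eventually hq hκ,
    eventually_forall_of_eventually (eventually_ge_atTop 1) hκ] with ω h1 h2 h3 h4 j hj
  specialize h1 j hj
  specialize h2 j hj
  specialize h3 j hj
  have hj1 : (1 : ℝ) ≤ j := by exact_mod_cast h4 j hj
  have h5 := le_log_threshold m hε0 hε1 q j
  rw [abs_le] at h1
  set T := Real.log (threshold m ε q j)
  set R := Rplus q ω j
  have hsj : √(j : ℝ) ≤ j := by
    rw [Real.sqrt_le_left (by positivity)]
    nlinarith
  have hdj : d * √(j : ℝ) ≤ 1 / 4 * j := mul_le_mul hd4 hsj (Real.sqrt_nonneg _) (by norm_num)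
  -- Enough room is left for `R⁺ ≥ j`: `1.38 - 1/8 - 1/4 > 1`.
  have hlog : (j : ℝ) * 1.38 ≤ 2 * (j * Real.log 2) := by nlinarith [Real.log_two_gt_d9]
  have hT : (j : ℝ) ≤ 2 * T := by linarith
  have hR : (j : ℝ) ≤ R := by linarith
  have key : ∀ a b : ℝ, (j : ℝ) ≤ b → a ≤ b + 3 * (d * √(j : ℝ)) → √a ≤ √b + c := by
    intro a b hb hab
    have hb0 : 0 ≤ b := by linarith
    rw [Real.sqrt_le_left (by positivity)]
    have e1 : √(j : ℝ) ≤ √b := Real.sqrt_le_sqrt hb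
    have e2 : 3 * d * √(j : ℝ) ≤ c * √b := mul_le_mul hdc e1 (Real.sqrt_nonneg _) hc.le
    have e3 := Real.sq_sqrt hb0
    have e4 : 0 ≤ c * √b := by positivity
    nlinarith
  have hdj0 : 0 ≤ d * √(j : ℝ) := by positivity
  exact ⟨key _ _ hT (by linarith), key _ _ hR (by linarith), hR⟩

/-! ### Typical bandwidths under the prior. -/

theorem IsPriorShape.eventually_half_le_tsum {ν : ℝ → ℝ} (hν : IsPriorShape ν) :
    ∀ᶠ ω : ℝ in atTop, ω / 2 ≤ ∑' k : ℕ, ν (((k : ℝ) + 1) / ω) := by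
  filter_upwards [hν.riemann_sum.eventually_const_le (by norm_num : (1 / 2 : ℝ) < 1),
    eventually_gt_atTop 0] with ω h hω
  rw [one_div_mul_eq_div, le_div_iff₀ hω] at h
  linarith

theorem IsPriorShape.prior_nonneg {ν : ℝ → ℝ} (hν : IsPriorShape ν) {ω : ℝ} (hω : 0 < ω) (j : ℕ) :
    0 ≤ prior ν ω j := by
  refine div_nonneg (hν.nonneg _ (div_pos ?_ hω)) (tsum_nonneg fun k => hν.nonneg _ (by positivity))
  linarith [one_le_level j]

/-- The normalizing sum is eventually positive; since a divergent `∑'` is `0`, it converges and the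
prior is a genuine probability. -/
theorem IsPriorShape.eventually_tsum_prior {ν : ℝ → ℝ} (hν : IsPriorShape ν) :
    ∀ᶠ ω : ℝ in atTop, ∑' j, ENNReal.ofReal (prior ν ω j) = 1 := by
  filter_upwards [hν.eventually_half_le_tsum, eventually_gt_atTop 0] with ω hZ hω
  have hZ0 : 0 < ∑' k : ℕ, ν (((k : ℝ) + 1) / ω) := by linarith
  have hs : Summable fun k : ℕ => ν (((k : ℝ) + 1) / ω) := by
    by_contra h
    rw [tsum_eq_zero_of_not_summable h] at hZ0
    exact lt_irrefl _ hZ0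
  have he : prior ν ω = fun j : ℕ => ν (((j : ℝ) + 1) / ω) / ∑' k : ℕ, ν (((k : ℝ) + 1) / ω) := by
    ext j
    rw [prior, level_eq]
  rw [← ENNReal.ofReal_tsum_of_nonneg (hν.prior_nonneg hω) (by rw [he]; exact hs.div_const _), he,
    tsum_div_const, div_self hZ0.ne', ENNReal.ofReal_one]

/-- The prior puts little mass on resolution levels of a smaller order than `ω`. -/
theorem IsPriorShape.exists_tsum_prior_small {ν : ℝ → ℝ} (hν : IsPriorShape ν) {e : ℝ}
    (he : 0 < e) : ∃ κ : ℝ, 0 < κ ∧ ∀ᶠ ω : ℝ in atTop,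
      ∑' j : ℕ, ENNReal.ofReal (prior ν ω j) *
        Set.indicator {j : ℕ | (j : ℝ) + 1 ≤ κ * ω} 1 j ≤ ENNReal.ofReal e := by
  obtain ⟨M, hM⟩ := hν.bounded
  have hM0 : 0 ≤ M := (hν.nonneg 1 one_pos).trans (hM 1 one_pos)
  -- At most `κω` levels carry mass at most `2M/ω` each; `M + 1` also covers `M = 0`.
  refine ⟨e / (2 * (M + 1)), by positivity, ?_⟩
  filter_upwards [hν.eventually_half_le_tsum, eventually_gt_atTop 0] with ω hZ hω
  set κ := e / (2 * (M + 1)) with hκ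
  have hκ0 : 0 < κ := by positivity
  rw [tsum_eq_sum (s := Finset.range ⌊κ * ω⌋₊)]
  · have hle : ∀ j ∈ Finset.range ⌊κ * ω⌋₊, ENNReal.ofReal (prior ν ω j) *
        Set.indicator {j : ℕ | (j : ℝ) + 1 ≤ κ * ω} 1 j ≤ ENNReal.ofReal (M / (ω / 2)) := by
      intro j _
      refine (mul_le_of_le_one_right' (Set.indicator_le_self' (by simp) j)).trans ?_
      refine ENNReal.ofReal_le_ofReal ?_
      exact div_le_div₀ hM0 (hM _ (div_pos (by linarith [one_le_level j]) hω)) (by positivity) hZ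
    refine (Finset.sum_le_sum hle).trans ?_
    rw [Finset.sum_const, Finset.card_range, nsmul_eq_mul, ← ENNReal.ofReal_natCast,
      ← ENNReal.ofReal_mul (by positivity)]
    refine ENNReal.ofReal_le_ofReal ?_
    calc (⌊κ * ω⌋₊ : ℝ) * (M / (ω / 2)) ≤ κ * ω * ((M + 1) / (ω / 2)) := by
          gcongr
          · exact Nat.floor_le (by positivity)
          · linarith
      _ = e := by rw [hκ]; field_simp
  · intro j hj
    rw [Finset.mem_range, not_lt] at hj
    have h : κ * ω < (j : ℝ) + 1 := (Nat.lt_floor_add_one _).trans_le (by gcongr)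
    rw [Set.indicator_of_notMem (by simpa using h), mul_zero]

/-- With a large prior probability the resolution level is at least of the order `ω` and `F` is at
most `δ log* ω`, if the positive part of `F` has an expectation of a smaller order than `log* ω`. -/
theorem IsPriorShape.exists_tsum_prior_atypical_le {ν : ℝ → ℝ} (hν : IsPriorShape ν) {e δ : ℝ}
    (he : 0 < e) (hδ : 0 < δ) {F : ℝ → ℕ → ℝ}
    (hF : Tendsto (fun ω => expectPos ν ω (F ω) / ENNReal.ofReal (logStar ω)) atTop (𝓝 0)) :
    ∃ κ : ℝ, 0 < κ ∧ ∀ᶠ ω : ℝ in atTop,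
      ∑' j : ℕ, ENNReal.ofReal (prior ν ω j) *
        Set.indicator {j : ℕ | κ * ω < (j : ℝ) + 1 ∧ F ω j ≤ δ * logStar ω}ᶜ 1 j ≤
        ENNReal.ofReal e := by
  obtain ⟨κ, hκ, hsmall⟩ := hν.exists_tsum_prior_small (half_pos he)
  refine ⟨κ, hκ, ?_⟩
  have hL : Tendsto logStar atTop atTop := Real.tendsto_log_atTop.comp Real.tendsto_log_atTop
  filter_upwards [hsmall, hL.eventually_gt_atTop 0, hF.eventually_le_const
    (ENNReal.ofReal_pos.2 (by positivity : 0 < δ * (e / 2)))] with ω h1 hL0 h2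
  -- Pointwise form of Markov's inequality, joined with the union bound over the two ways to be
  -- atypical.
  have hpt : ∀ j : ℕ, ENNReal.ofReal (prior ν ω j) *
      Set.indicator {j : ℕ | κ * ω < (j : ℝ) + 1 ∧ F ω j ≤ δ * logStar ω}ᶜ 1 j ≤
      ENNReal.ofReal (prior ν ω j) * Set.indicator {j : ℕ | (j : ℝ) + 1 ≤ κ * ω} 1 j +
      ENNReal.ofReal (prior ν ω j) * ENNReal.ofReal (max (F ω j) 0) /
        ENNReal.ofReal (δ * logStar ω) := by
    intro j
    rw [mul_div_assoc, ← mul_add]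
    gcongr
    by_cases hj1 : (j : ℝ) + 1 ≤ κ * ω
    · refine le_add_right ?_
      rw [Set.indicator_of_mem (s := {j : ℕ | (j : ℝ) + 1 ≤ κ * ω}) hj1]
      exact Set.indicator_le_self' (by simp) j
    · by_cases hj2 : F ω j ≤ δ * logStar ω
      · rw [Set.indicator_of_notMem]
        · exact zero_le
        · simpa using ⟨not_le.1 hj1, hj2⟩
      · refine le_add_left ((Set.indicator_le_self' (by simp) j).trans ?_)
        rw [Pi.one_apply, ENNReal.le_div_iff_mul_le (Or.inl (by simp; positivity)) (Or.inl (by simp)), one_mul]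
        exact ENNReal.ofReal_le_ofReal ((not_le.1 hj2).le.trans (le_max_left _ _))
  refine (ENNReal.tsum_le_tsum hpt).trans ?_
  rw [ENNReal.tsum_add]
  simp_rw [div_eq_mul_inv]
  rw [ENNReal.tsum_mul_right, ← div_eq_mul_inv]
  have h3 : (∑' j, ENNReal.ofReal (prior ν ω j) * ENNReal.ofReal (max (F ω j) 0)) /
      ENNReal.ofReal (δ * logStar ω) ≤ ENNReal.ofReal (e / 2) := by
    rw [ENNReal.div_le_iff (by simp; positivity) (by simp)] at h2 ⊢
    refine h2.trans_eq ?_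
    rw [← ENNReal.ofReal_mul (by positivity), ← ENNReal.ofReal_mul (by positivity)]
    congr 1
    ring
  refine (add_le_add h1 h3).trans_eq ?_
  rw [← ENNReal.ofReal_add (by positivity) (by positivity), add_halves]

/-! ### Averaging over the prior and the two halves of the theorem. -/

instance isProbabilityMeasure_obsLaw (σ : ℝ) (θ : Loc → ℝ) : IsProbabilityMeasure (obsLaw σ θ) := by
  have : IsProbabilityMeasure noiseLaw := by
    unfold noiseLaw
    infer_instance
  exact Measure.isProbabilityMeasure_map
    (measurable_pi_lambda _ fun p => ((measurable_pi_apply p).const_mul _).const_add _).aemeasurable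

theorem typeII_le_one (m : ℕ) (ε σ α : ℝ) (p : Loc) (A : ℝ) : typeII m ε σ α p A ≤ 1 :=
  iSup₂_le fun _ _ => prob_le_one

theorem ofReal_div_gridSize_mul_sum_const {r : ℝ} (j : ℕ) (b : ℝ≥0∞) :
    ENNReal.ofReal (r / gridSize j) * ∑ _i : Fin (2 ^ j), b = ENNReal.ofReal r * b := by
  have h : ((2 ^ j : ℕ) : ℝ≥0∞) = ENNReal.ofReal (2 ^ j) := by
    rw [← ENNReal.ofReal_natCast]
    push_cast
    rfl
  rw [Finset.sum_const, Finset.card_univ, Fintype.card_fin, nsmul_eq_mul, ← mul_assoc, h,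
    gridSize_eq_two_pow, ← ENNReal.ofReal_mul' (by positivity),
    div_mul_cancel₀ _ (by positivity)]

/-- A bound for the type II error on a set of typical bandwidths bounds the average from below. -/
theorem le_avgTypeII_add {m : ℕ} {ε σ α : ℝ} {ν : ℝ → ℝ} {ω : ℝ} {A : ℕ → ℝ} {G : Set ℕ}
    {b e : ℝ≥0∞} (h1 : ∑' j, ENNReal.ofReal (prior ν ω j) = 1)
    (hG : ∑' j, ENNReal.ofReal (prior ν ω j) * Set.indicator Gᶜ 1 j ≤ e) (hb1 : b ≤ 1)
    (hb : ∀ j ∈ G, ∀ i, b ≤ typeII m ε σ α ⟨j, i⟩ (A j)) :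
    b ≤ avgTypeII m ε σ α ν ω A + e := by
  calc b = ∑' j, ENNReal.ofReal (prior ν ω j) * b := by rw [ENNReal.tsum_mul_right, h1, one_mul]
    _ ≤ ∑' j, (ENNReal.ofReal (prior ν ω j / gridSize j) *
          ∑ i : Fin (2 ^ j), typeII m ε σ α ⟨j, i⟩ (A j) +
          ENNReal.ofReal (prior ν ω j) * Set.indicator Gᶜ 1 j) := by
        refine ENNReal.tsum_le_tsum fun j => ?_
        by_cases hj : j ∈ G
        · refine le_add_right ?_
          rw [← ofReal_div_gridSize_mul_sum_const j b]
          gcongr with i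
          exact hb j hj i
        · refine le_add_left ?_
          rw [Set.indicator_of_mem (s := Gᶜ) hj]
          gcongr
          exact hb1
    _ ≤ _ := by
        rw [ENNReal.tsum_add]
        exact add_le_add le_rfl hG

/-- A bound for the type II error on a set of typical bandwidths bounds the average from above. -/
theorem avgTypeII_le_add {m : ℕ} {ε σ α : ℝ} {ν : ℝ → ℝ} {ω : ℝ} {A : ℕ → ℝ} {G : Set ℕ}
    {b e : ℝ≥0∞} (h1 : ∑' j, ENNReal.ofReal (prior ν ω j) = 1)
    (hG : ∑' j, ENNReal.ofReal (prior ν ω j) * Set.indicator Gᶜ 1 j ≤ e)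
    (hb : ∀ j ∈ G, ∀ i, typeII m ε σ α ⟨j, i⟩ (A j) ≤ b) :
    avgTypeII m ε σ α ν ω A ≤ b + e := by
  calc avgTypeII m ε σ α ν ω A
      ≤ ∑' j, (ENNReal.ofReal (prior ν ω j) * b +
          ENNReal.ofReal (prior ν ω j) * Set.indicator Gᶜ 1 j) := by
        refine ENNReal.tsum_le_tsum fun j => ?_
        by_cases hj : j ∈ G
        · refine le_add_right ?_
          rw [← ofReal_div_gridSize_mul_sum_const j b]
          gcongr with i
          exact hb j hj i
        · refine le_add_left ?_
          rw [Set.indicator_of_mem (s := Gᶜ) hj, Pi.one_apply,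
            ← ofReal_div_gridSize_mul_sum_const (r := prior ν ω j) j 1]
          exact mul_le_mul_right (Finset.sum_le_sum fun i _ => typeII_le_one _ _ _ _ _ _) _
    _ ≤ _ := by
        rw [ENNReal.tsum_add, ENNReal.tsum_mul_right, h1, one_mul]
        exact add_le_add le_rfl hG

theorem tendsto_logStar : Tendsto logStar atTop atTop :=
  Real.tendsto_log_atTop.comp Real.tendsto_log_atTop

/-- This gives `δ log* ω < j ≤ R⁺` on typical levels, which rules out the wrong sign when a square
root is taken in (ii). -/
theorem eventually_mul_logStar_lt (δ : ℝ) {κ : ℝ} (hκ : 0 < κ) :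
    ∀ᶠ ω : ℝ in atTop, δ * logStar ω < κ * ω - 1 := by
  have h := (((Real.isLittleO_log_id_atTop.comp_tendsto Real.tendsto_log_atTop).trans
    Real.isLittleO_log_id_atTop).const_mul_left δ).bound (half_pos hκ)
  filter_upwards [h, eventually_gt_atTop (2 / κ), eventually_gt_atTop 0] with ω h1 h2 h3
  rw [div_lt_iff₀ hκ] at h2
  simp only [Function.comp, id, Real.norm_eq_abs, abs_of_pos h3] at h1
  have := le_abs_self (δ * logStar ω)
  simp only [logStar] at this ⊢
  linarith

/-- On typical levels the slack `δ log* ω` in the hypothesis absorbs the error of Markov's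
inequality, leaving `(A_h/σ_h - x)² ≤ R⁺`. -/
theorem le_liminf_avgTypeII (σ : ℝ) (hσ : 0 < σ) (α : ℝ) (hα0 : 0 < α) (hα1 : α < 1)
    (m : ℕ) (ε : ℝ) (hε0 : 0 < ε) (hε1 : ε < 1)
    (ν : ℝ → ℝ) (hν : IsPriorShape ν) (A : ℝ → ℕ → ℝ) (x δ : ℝ) (hδ : 0 < δ)
    (h : Tendsto (fun ω : ℝ =>
          expectPos ν ω (fun j => (A ω j / noiseLevel σ j - x) ^ 2 + δ * logStar ω
              - Rplus (critLevel α) ω j) / ENNReal.ofReal (logStar ω))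
        atTop (𝓝 0)) :
      ENNReal.ofReal ((1 - α) * (1 - stdPhi x)) ≤
        liminf (fun ω : ℝ => avgTypeII m ε σ α ν ω (A ω)) atTop := by
  refine ENNReal.le_of_forall_pos_le_add fun r hr _ => ?_
  have hr2 : (0 : ℝ) < r / 2 := by positivity
  obtain ⟨c, hc, hcΦ⟩ : ∃ c : ℝ, 0 < c ∧ stdPhi (x + c) ≤ stdPhi x + r / 2 := by
    have h1 : Tendsto stdPhi (𝓝[>] x) (𝓝 (stdPhi x)) :=
      (continuousWithinAt_stdPhi x).mono_left (nhdsWithin_mono _ Set.Ioi_subset_Ici_self)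
    obtain ⟨y, hy, hxy⟩ := ((h1.eventually_le_const (by linarith : stdPhi x < stdPhi x + r / 2)).and
      self_mem_nhdsWithin).exists
    exact ⟨y - x, sub_pos.2 hxy, by rwa [add_sub_cancel]⟩
  obtain ⟨κ, hκ, hbad⟩ := hν.exists_tsum_prior_atypical_le hr2 hδ h
  rw [← tsub_le_iff_right]
  refine le_liminf_of_le (by isBoundedDefault) ?_
  -- The margin `c` from right continuity of `Φ` is shared: `c/2` for the quantile, `c/2` for
  -- replacing `√R⁺` by `√(2 log s)`.
  have hquant := (tendsto_log_threshold m hε0 hε1 (critLevel α)).eventually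
    (eventually_le_stdPhi (half_pos hc))
  filter_upwards [hbad, hν.eventually_tsum_prior, eventually_forall_of_eventually hquant hκ,
    eventually_Rplus_approx m hε0 hε1 (critLevel α) hκ (half_pos hc)] with ω hbad hsum hq hR
  have hΦ1 := stdPhi_lt_one (x + c)
  have hΦ0 := stdPhi_pos (x + c)
  have key : ENNReal.ofReal ((1 - α) * (1 - stdPhi (x + c))) ≤
      avgTypeII m ε σ α ν ω (A ω) + ENNReal.ofReal (r / 2) := by
    refine le_avgTypeII_add hsum hbad ?_ ?_
    · rw [ENNReal.ofReal_le_one]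
      nlinarith
    · rintro j ⟨hj1, hj2⟩ i
      have hq := hq j hj1
      obtain ⟨hR1, -, hRj⟩ := hR j hj1
      rw [Real.exp_log (threshold_pos m hε0 hε1 _ j)] at hq
      refine le_trans (ENNReal.ofReal_le_ofReal ?_)
        (le_typeII m hε0 hε1 hσ hα0 hα1 ⟨j, i⟩ (A ω j) _ hq)
      have h1 : A ω j / noiseLevel σ j - x ≤ √(Rplus (critLevel α) ω j) :=
        Real.le_sqrt_of_sq_le (by linarith)
      refine mul_le_mul_of_nonneg_left (sub_le_sub_left (stdPhi_mono ?_) 1) (by linarith)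
      linarith
  rw [tsub_le_iff_right]
  calc ENNReal.ofReal ((1 - α) * (1 - stdPhi x))
      ≤ ENNReal.ofReal ((1 - α) * (1 - stdPhi (x + c)) + r / 2) := by
        refine ENNReal.ofReal_le_ofReal ?_
        nlinarith
    _ ≤ ENNReal.ofReal ((1 - α) * (1 - stdPhi (x + c))) + ENNReal.ofReal (r / 2) :=
        ENNReal.ofReal_add_le
    _ ≤ avgTypeII m ε σ α ν ω (A ω) + ENNReal.ofReal (r / 2) + ENNReal.ofReal (r / 2) := by gcongr
    _ = avgTypeII m ε σ α ν ω (A ω) + r := by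
        rw [add_assoc, ← ENNReal.ofReal_add hr2.le hr2.le, add_halves, ENNReal.ofReal_coe_nnreal]

/-- Completing the square, the hypothesis on typical levels reads `R⁺ ≤ (A_h/σ_h - √(δ log* ω))²`.
-/
theorem tendsto_avgTypeII_zero (σ : ℝ) (hσ : 0 < σ) (α : ℝ)
    (m : ℕ) (ε : ℝ) (hε0 : 0 < ε) (hε1 : ε < 1)
    (ν : ℝ → ℝ) (hν : IsPriorShape ν)
    (A : ℝ → ℕ → ℝ) (hA : ∀ ω j, 0 ≤ A ω j) (δ : ℝ) (hδ : 0 < δ)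
    (h : Tendsto (fun ω : ℝ =>
          expectPos ν ω (fun j => Rplus (critLevel α) ω j
              + 2 * √(δ * logStar ω) * (A ω j / noiseLevel σ j)
              - A ω j ^ 2 / noiseLevel σ j ^ 2) / ENNReal.ofReal (logStar ω))
        atTop (𝓝 0)) :
      Tendsto (fun ω : ℝ => avgTypeII m ε σ α ν ω (A ω)) atTop (𝓝 0) := by
  rw [ENNReal.tendsto_nhds_zero]
  intro r hr
  obtain ⟨e, he, her⟩ : ∃ e : ℝ, 0 < e ∧ ENNReal.ofReal e + ENNReal.ofReal e ≤ r := by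
    obtain ⟨s, hs, hsr⟩ := ENNReal.lt_iff_exists_nnreal_btwn.1 hr
    have hs0 : (0 : ℝ) < s := by exact_mod_cast hs
    refine ⟨s / 2, by positivity, ?_⟩
    rw [← ENNReal.ofReal_add (by positivity) (by positivity), add_halves, ENNReal.ofReal_coe_nnreal]
    exact hsr.le
  obtain ⟨K, hK⟩ : ∃ K, 1 - e ≤ stdPhi K :=
    ((tendsto_cdf_atTop (gaussianReal 0 1)).eventually_const_le (by linarith : 1 - e < 1)).exists
  obtain ⟨κ, hκ, hbad⟩ := hν.exists_tsum_prior_atypical_le he hδ h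
  have hquant := (tendsto_log_threshold m hε0 hε1 (critLevel α)).eventually
    (eventually_stdPhi_lt one_pos)
  have hsqrt : Tendsto (fun ω => √(δ * logStar ω)) atTop atTop :=
    Real.tendsto_sqrt_atTop.comp (tendsto_logStar.const_mul_atTop hδ)
  filter_upwards [hbad, hν.eventually_tsum_prior, eventually_forall_of_eventually hquant hκ,
    eventually_Rplus_approx m hε0 hε1 (critLevel α) hκ one_pos, eventually_mul_logStar_lt δ hκ,
    -- One unit is lost to the quantile and one to the comparison of square roots.
    hsqrt.eventually_ge_atTop (K + 2), tendsto_logStar.eventually_gt_atTop 0]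
    with ω hbad hsum hq hR hlt hKω hL0
  refine le_trans (avgTypeII_le_add hsum hbad ?_) her
  rintro j ⟨hj1, hj2⟩ i
  have hq := hq j hj1
  obtain ⟨-, hR1, hRj⟩ := hR j hj1
  rw [Real.exp_log (threshold_pos m hε0 hε1 _ j)] at hq
  refine (typeII_le m hε0 hε1 hσ α ⟨j, i⟩ (A ω j) _ hq).trans (ENNReal.ofReal_le_ofReal ?_)
  have ha : 0 ≤ A ω j / noiseLevel σ j := div_nonneg (hA ω j) (noiseLevel_pos hσ j).le
  rw [← div_pow] at hj2
  simp only
  set a := A ω j / noiseLevel σ j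
  set R := Rplus (critLevel α) ω j
  have hD := Real.sq_sqrt (by positivity : 0 ≤ δ * logStar ω)
  have hDR : √(δ * logStar ω) < √R := Real.sqrt_lt_sqrt (by positivity) (by linarith)
  have h1 : √R ≤ |a - √(δ * logStar ω)| := Real.sqrt_le_iff.2 ⟨abs_nonneg _, by
    rw [sq_abs]
    linarith⟩
  have h2 : √R ≤ a - √(δ * logStar ω) := by
    -- The negative sign would give `√R⁺ ≤ √(δ log* ω)`, as amplitudes are nonnegative, against
    -- `hDR`.
    rcases le_abs.1 h1 with h1 | h1
    · exact h1
    · linarith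
  have h3 : K ≤ a - (√(2 * Real.log (threshold m ε (critLevel α) j)) + 1) := by linarith
  linarith [stdPhi_mono h3]

end MonotonicityTest

theorem mainTheorem3 (σ : ℝ) (hσ : 0 < σ) (α : ℝ) (hα0 : 0 < α) (hα1 : α < 1)
    (m : ℕ) (ε : ℝ) (hε0 : 0 < ε) (hε1 : ε < 1)
    (ν : ℝ → ℝ) (hν : IsPriorShape ν)
    (A : ℝ → ℕ → ℝ) (hA : ∀ ω j, 0 ≤ A ω j) :
    (∀ x δ : ℝ, 0 < δ →
      Tendsto (fun ω : ℝ =>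
          expectPos ν ω (fun j => (A ω j / noiseLevel σ j - x) ^ 2 + δ * logStar ω
              - Rplus (critLevel α) ω j) / ENNReal.ofReal (logStar ω))
        atTop (𝓝 0) →
      ENNReal.ofReal ((1 - α) * (1 - stdPhi x)) ≤
        liminf (fun ω : ℝ => avgTypeII m ε σ α ν ω (A ω)) atTop) ∧
    (∀ δ : ℝ, 0 < δ →
      Tendsto (fun ω : ℝ =>
          expectPos ν ω (fun j => Rplus (critLevel α) ω j
              + 2 * √(δ * logStar ω) * (A ω j / noiseLevel σ j)
              - A ω j ^ 2 / noiseLevel σ j ^ 2) / ENNReal.ofReal (logStar ω))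
        atTop (𝓝 0) →
      Tendsto (fun ω : ℝ => avgTypeII m ε σ α ν ω (A ω)) atTop (𝓝 0)) :=
  ⟨fun x δ hδ h => le_liminf_avgTypeII σ hσ α hα0 hα1 m ε hε0 hε1 ν hν A x δ hδ h,
    fun δ hδ h => tendsto_avgTypeII_zero σ hσ α m ε hε0 hε1 ν hν A hA δ hδ h⟩
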